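/- Let $(X,d)$ be a Polish metric space, i.e. a complete separable metric space, and let $\mathrm{Iso}(X,d)$ be the group of isometries of $X$ onto itself with the topology of pointwise convergence. Let $G$ be a closed subgroup of $\mathrm{Iso}(X,d)$, let $\tau$ be the topology of pointwise convergence on $G$, and let $\partial(g,h)=\sup_{x\in X}d(gx,hx)$ be the metric of uniform convergence on $G$. For a set $Y$ with a distance $\delta$, $A\subseteq Y$ and $\varepsilon>0$, write $(A)_\varepsilon=\{y\in Y:\delta(y,A)<\varepsilon\}$. Powers $X^n$ and $G^n$ carry the supremum metrics induced by $d$ and $\partial$ respectively, and $G^n$ carries the product topology induced by $\tau$. Suppose that 1. the action of $G$ on $X$ is approximately oligomorphic: for every $n\in\mathbb N$ and $\varepsilon>0$ there are finitely many tuples $\bar b_1,\dots,\bar b_k\in X^n$ such that for each $\bar x\in X^n$ there are $j\in\{1,\dots,k\}$ and $g\in G$ with $d(g\cdot\bar b_j,\bar x)\le\varepsilon$; and 2. $(G,\tau,\partial)$ has ample generics: for every $n\in\mathbb N$ and $\varepsilon>0$ there is $\bar g=(g_1,\dots,g_n)\in G^n$ such that the $\varepsilon$-enlargement $(\{(hg_1h^{-1},\dots,hg_nh^{-1}):h\in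 G\})_\varepsilon$ of its diagonal conjugacy class, taken with respect to the supremum metric, is co-meagre in $G^n$ for the product topology. Then $(G,\partial)$ is metrically $21$-Bergman: for every increasing sequence $W_0\subseteq W_1\subseteq\cdots$ of subsets of $G$ with $\bigcup_nW_n=G$ and every $\varepsilon>0$ there is $n$ such that $G=\bigl((W_n)_\varepsilon\bigr)^{21}$, i.e. every element of $G$ is a product of $21$ elements of $(W_n)_\varepsilon$, the enlargement being taken with respect to $\partial$. -/

import Mathlib

open scoped Pointwise ENNReal

namespace Topometric

/-- The isometry group of a metric space acts on the space by evaluation. -/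
instance isoMulAction {X : Type*} [MetricSpace X] : MulAction (X ≃ᵢ X) X where
  smul g x := g x
  one_smul _ := rfl
  mul_smul _ _ _ := rfl

instance isoIsIsometricSMul {X : Type*} [MetricSpace X] : IsIsometricSMul (X ≃ᵢ X) X where
  isometry_smul g := g.isometry

instance subgroupIsIsometricSMul {X : Type*} [MetricSpace X] (G : Subgroup (X ≃ᵢ X)) :
    IsIsometricSMul G X where
  isometry_smul g := (g : X ≃ᵢ X).isometry

/-- The topology of pointwise convergence on the isometry group: the one induced from
the product topology on `X → X`. Subgroups carry the subspace topology. -/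
instance isoPointwiseTopology {X : Type*} [MetricSpace X] : TopologicalSpace (X ≃ᵢ X) :=
  TopologicalSpace.induced (fun g : X ≃ᵢ X => (g : X → X)) Pi.topologicalSpace

/-- The metric of uniform convergence, `∂(g, h) = sup_x d(g x, h x)`, on a group acting on a
metric space. It takes values in `[0, ∞]`; it is finite as soon as the space is bounded. -/
noncomputable def uniformDist (G : Type*) {X : Type*} [MetricSpace X] [SMul G X]
    (g h : G) : ℝ≥0∞ :=
  ⨆ x : X, edist (g • x) (h • x)

/-- The supremum metric on `n`-tuples associated with a distance `δ`. -/
noncomputable def supDist {Y : Type*} (δ : Y → Y → ℝ≥0∞) (n : ℕ) (x y : Fin n → Y) : ℝ≥0∞ :=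
  ⨆ i, δ (x i) (y i)

/-- The enlargement `(A)_ε = {x | δ(x, A) < ε}`, where `δ(x, A)` is the infimum of `δ x a`
over `a ∈ A`; that infimum is below `ε` exactly when some `δ x a` is. -/
def enlarge {Y : Type*} (δ : Y → Y → ℝ≥0∞) (A : Set Y) (ε : ℝ) : Set Y :=
  {x | ∃ a ∈ A, δ x a < ENNReal.ofReal ε}

/-- Ample generics for an action of `G` on `Y`, where `Y` carries a topology and a distance
`δ`: for every `n` and `ε > 0` there is an `n`-tuple whose diagonal orbit has a co-meagre
`ε`-enlargement in `Yⁿ` (product topology, supremum distance). -/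
def ActionHasAmpleGenerics (G Y : Type*) [Group G] [MulAction G Y] [TopologicalSpace Y]
    (δ : Y → Y → ℝ≥0∞) : Prop :=
  ∀ (n : ℕ) (ε : ℝ), 0 < ε → ∃ x : Fin n → Y,
    enlarge (supDist δ n) (MulAction.orbit G x) ε ∈ residual (Fin n → Y)

/-- A group with a topology and a distance has ample generics if its action on itself by
conjugation does. -/
def HasAmpleGenerics (G : Type*) [Group G] [TopologicalSpace G] (δ : G → G → ℝ≥0∞) : Prop :=
  ActionHasAmpleGenerics (ConjAct G) G δ

/-- An isometric action of `G` on `M` is approximately oligomorphic if for every `n` and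
`ε > 0` there are finitely many `n`-tuples such that every `n`-tuple is within `ε` (for the
supremum metric on `Mⁿ`) of a `G`-translate of one of them. -/
def ApproximatelyOligomorphic (G M : Type*) [Group G] [MetricSpace M] [MulAction G M]
    [IsIsometricSMul G M] : Prop :=
  ∀ (n : ℕ) (ε : ℝ), 0 < ε → ∃ B : Finset (Fin n → M),
    ∀ x : Fin n → M, ∃ b ∈ B, ∃ g : G, dist (g • b) x ≤ ε

/-- `(G, δ)` is metrically `k`-Bergman: for every increasing exhaustive sequence `W` of
subsets of `G` and every `ε > 0` there is `n` such that every element of `G` is a product of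
`k` elements of `(W n)_ε`. -/
def MetricallyBergman (G : Type*) [Group G] (δ : G → G → ℝ≥0∞) (k : ℕ) : Prop :=
  ∀ W : ℕ → Set G, Monotone W → (⋃ n, W n) = Set.univ → ∀ ε : ℝ, 0 < ε →
    ∃ n, (enlarge δ (W n) ε) ^ k = Set.univ

end Topometric

/-! Some enlargement of a set in the sequence has a sixth power that is a neighbourhood of the
identity, and finitely many double cosets of that neighbourhood cover `G`.

The first half is a diagonal argument. If, for every `n`, the complement of the enlargement of `W n
* W n * W n` were nonmeagre in every nonempty open set, `HasAmpleGenerics.exists_conj_seq` would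
give a single `h` conjugating, for each `k`, some element of the `k`-th nonmeagre set to within `ε /
2` of the `k`-th complement. But `h` itself lies in some `W k`, which is absurd. So an enlarged
triple product is comeagre in an open set, and Pettis's lemma doubles 3 to 6. The element `h` is a
limit of successive corrections. Each is possible because generic tuples are approximately
conjugate, and the near-conjugates of a point by a small open set form an analytic set, which has
the Baire property.

The second half is approximate oligomorphicity applied to the pairs `(a, g • a)`. With the double
coset representatives absorbed into the enlargement, 6 + 1 + 6 = 13 factors suffice, and the
identity pads them to 21. -/

open Set Topology Filter MeasureTheory

namespace Topometric

/-! ### Baire category: hulls, analytic sets and Kuratowski–Ulam. -/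

section Baire

variable {X : Type*} [TopologicalSpace X]

/-- A Baire measurable set that is not meagre is comeagre in some nonempty open set. -/
theorem exists_isOpen_isMeagre_diff {S : Set X} (hS : BaireMeasurableSet S)
    (hne : ¬ IsMeagre S) : ∃ U : Set X, IsOpen U ∧ U.Nonempty ∧ IsMeagre (U \ S) := by
  obtain ⟨U, hU, hSU⟩ := hS.residualEq_isOpen
  refine ⟨U, hU, ?_, ?_⟩
  · rw [nonempty_iff_ne_empty]
    rintro rfl
    apply hne
    filter_upwards [hSU] with x hx h
    exact (hx.mp h).elim
  · filter_upwards [hSU] with x hx h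
    exact h.2 (hx.mpr h.1)

/-- Every set has a Baire measurable hull, minimal up to a meagre set. -/
theorem exists_baireMeasurableSet_hull [SecondCountableTopology X] (A : Set X) :
    ∃ H : Set X, A ⊆ H ∧ H ⊆ closure A ∧ BaireMeasurableSet H ∧
      ∀ B : Set X, BaireMeasurableSet B → A ⊆ B → IsMeagre (H \ B) := by
  set b := TopologicalSpace.countableBasis X
  -- `M` is the largest open set in which `A` is meagre; a countable basis keeps the union
  -- countable.
  set M : Set X := ⋃ U ∈ {U ∈ b | IsMeagre (A ∩ U)}, U with hM
  have hb := TopologicalSpace.isBasis_countableBasis X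
  have hMo : IsOpen M := isOpen_biUnion fun U hU => hb.isOpen hU.1
  have hAM : IsMeagre (A ∩ M) := by
    rw [hM, inter_iUnion₂]
    exact isMeagre_biUnion ((TopologicalSpace.countable_countableBasis X).mono fun U hU => hU.1)
      fun U hU => hU.2
  have hmax : ∀ U, IsOpen U → IsMeagre (A ∩ U) → U ⊆ M := by
    intro U hU hm x hx
    obtain ⟨V, hV, hxV, hVU⟩ := hb.exists_subset_of_mem_open hx hU
    exact mem_biUnion (show V ∈ {U ∈ b | IsMeagre (A ∩ U)} from
      ⟨hV, hm.mono (inter_subset_inter_right _ hVU)⟩) hxV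
  refine ⟨Mᶜ ∪ A ∩ M, ?_, ?_, ?_, ?_⟩
  · intro x hx
    by_cases h : x ∈ M
    · exact Or.inr ⟨hx, h⟩
    · exact Or.inl h
  · refine union_subset ?_ (inter_subset_left.trans subset_closure)
    rw [compl_subset_comm]
    refine hmax _ isClosed_closure.isOpen_compl ?_
    rw [show A ∩ (closure A)ᶜ = ∅ from
      (disjoint_compl_right.mono_left subset_closure).inter_eq]
    exact IsMeagre.empty
  · exact hMo.baireMeasurableSet.compl.union hAM.baireMeasurableSet
  · intro B hB hAB
    -- A nonmeagre part of `Mᶜ` missing `B` would agree with an open `U` up to a meagre set. Then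
    -- `A` is meagre in `U`, which forces `U ⊆ M`.
    by_contra hne
    have hC : BaireMeasurableSet (Mᶜ \ B) := hMo.baireMeasurableSet.compl.diff hB
    have hCne : ¬ IsMeagre (Mᶜ \ B) := fun h => hne <| by
      refine h.mono ?_
      rintro x ⟨hx | hx, hxB⟩
      · exact ⟨hx, hxB⟩
      · exact (hxB (hAB hx.1)).elim
    obtain ⟨U, hU, hCU⟩ := hC.residualEq_isOpen
    have hUC : IsMeagre (U \ (Mᶜ \ B)) := by
      filter_upwards [hCU] with x hx h
      exact h.2 (hx.mpr h.1)
    have hUM : U ⊆ M := by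
      refine hmax U hU (hUC.mono ?_)
      rintro x ⟨hxA, hxU⟩
      exact ⟨hxU, fun h => h.2 (hAB hxA)⟩
    apply hCne
    filter_upwards [hCU] with x hx h
    exact h.1 (hUM (hx.mp h))

/-- Analytic sets have the Baire property. -/
theorem baireMeasurableSet_of_analyticSet [SecondCountableTopology X] [T2Space X] {S : Set X}
    (hS : AnalyticSet S) : BaireMeasurableSet S := by
  rw [AnalyticSet] at hS
  rcases hS with rfl | ⟨f, hf, rfl⟩
  · exact isOpen_empty.baireMeasurableSet
  let A : List ℕ → Set X := fun s => f '' {x | PiNat.res x s.length = s}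
  choose H hAH hHA hHm hHmin using fun s => exists_baireMeasurableSet_hull (A s)
  -- The discarded points lie in the hull of some node but in no hull of its children. Any other
  -- point of the root hull can be followed down a branch, whose image under `f` must be that point.
  have hE : IsMeagre (⋃ s, H s \ ⋃ k, H (k :: s)) := by
    refine isMeagre_iUnion fun s => hHmin s _ (BaireMeasurableSet.iUnion fun k => hHm _) ?_
    rintro _ ⟨x, hx, rfl⟩
    refine mem_iUnion.2 ⟨x s.length, hAH _ ⟨x, ?_, rfl⟩⟩
    simpa [PiNat.res_succ] using hx
  have key : H [] \ (⋃ s, H s \ ⋃ k, H (k :: s)) ⊆ range f := by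
    rintro x ⟨hx0, hx⟩
    have hnext : ∀ s, ∃ k, x ∈ H s → x ∈ H (k :: s) := by
      intro s
      by_cases h : x ∈ H s
      · by_contra! hk
        exact hx (mem_iUnion.2 ⟨s, h, fun h' => by
          obtain ⟨k, hk'⟩ := mem_iUnion.1 h'
          exact (hk k).2 hk'⟩)
      · exact ⟨0, fun h' => (h h').elim⟩
    choose k hk using hnext
    let L : ℕ → List ℕ := fun n => Nat.rec [] (fun _ s => k s :: s) n
    have hL : ∀ n, L (n + 1) = k (L n) :: L n := fun n => rfl
    have hLres : ∀ n, PiNat.res (fun n => k (L n)) n = L n := by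
      intro n
      induction n with
      | zero => rfl
      | succ n ih => rw [PiNat.res_succ, ih, hL]
    have hLH : ∀ n, x ∈ H (L n) := by
      intro n
      induction n with
      | zero => exact hx0
      | succ n ih => exact hk _ ih
    have hlen : ∀ n, (L n).length = n := by
      intro n
      rw [← hLres, PiNat.res_length]
    refine ⟨fun n => k (L n), ?_⟩
    by_contra hne
    obtain ⟨U, V, hU, hV, hxU, hfV, hUV⟩ := t2_separation (Ne.symm hne)
    obtain ⟨n, hn⟩ : ∃ n, PiNat.cylinder (fun n => k (L n)) n ⊆ f ⁻¹' V := by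
      obtain ⟨t, ⟨y, n, rfl⟩, hyt, htV⟩ :=
        (PiNat.isTopologicalBasis_cylinders (fun _ : ℕ => ℕ)).exists_subset_of_mem_open
          (show (fun n => k (L n)) ∈ f ⁻¹' V from hfV) (hV.preimage hf)
      exact ⟨n, by rwa [PiNat.mem_cylinder_iff_eq.1 hyt]⟩
    have hAV : A (L n) ⊆ V := by
      rintro _ ⟨z, hz, rfl⟩
      apply hn
      rw [PiNat.cylinder_eq_res]
      rw [mem_ofPred_eq, hlen] at hz
      rw [mem_ofPred_eq, hz, hLres]
    obtain ⟨z, hzU, hzV⟩ := mem_closure_iff.1 (closure_mono hAV (hHA _ (hLH n))) U hU hxU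
    exact hUV.le_bot ⟨hzU, hzV⟩
  have hfH : range f ⊆ H [] := by
    rintro _ ⟨x, rfl⟩
    exact hAH _ ⟨x, by simp, rfl⟩
  refine (hHm []).congr ?_
  filter_upwards [hE] with x hx
  exact propext ⟨fun h => key ⟨h, hx⟩, fun h => hfH h⟩

/-- Kuratowski–Ulam: almost all sections of a comeagre set of tuples are comeagre. -/
theorem eventually_residual_snoc [SecondCountableTopology X] {n : ℕ} {O : Set (Fin (n + 1) → X)}
    (hO : O ∈ residual (Fin (n + 1) → X)) :
    ∀ᶠ y in residual (Fin n → X), ∀ᶠ g in residual X, (Fin.snoc y g : Fin (n + 1) → X) ∈ O := by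
  have hopen : ∀ U : Set (Fin (n + 1) → X), IsOpen U → Dense U →
      ∀ᶠ y in residual (Fin n → X), {g | (Fin.snoc y g : Fin (n + 1) → X) ∈ U} ∈ residual X := by
    intro U hU hUd
    have hb := TopologicalSpace.isBasis_countableBasis X
    have hcount := TopologicalSpace.countable_countableBasis X
    -- For each basic open `V`, the `y` whose section of `U` meets `V` form a dense open set.
    -- Outside a meagre set of `y` this holds for all `V` at once, so the section is dense.
    have h : ∀ᶠ y in residual (Fin n → X), ∀ V ∈ TopologicalSpace.countableBasis X,
        V.Nonempty → ∃ g ∈ V, (Fin.snoc y g : Fin (n + 1) → X) ∈ U := by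
      rw [eventually_countable_ball hcount]
      intro V hV
      by_cases hVne : V.Nonempty
      swap
      · exact Eventually.of_forall fun y h => (hVne h).elim
      refine mem_of_superset (residual_of_dense_open
        (s := {y | ∃ g ∈ V, (Fin.snoc y g : Fin (n + 1) → X) ∈ U}) ?_ ?_) fun y hy _ => hy
      · have : {y : Fin n → X | ∃ g ∈ V, (Fin.snoc y g : Fin (n + 1) → X) ∈ U} =
            ⋃ g ∈ V, (fun y : Fin n → X => (Fin.snoc y g : Fin (n + 1) → X)) ⁻¹' U := by
          ext y; simp
        rw [this]
        exact isOpen_biUnion fun g _ => hU.preimage (continuous_id.finSnoc continuous_const)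
      · rw [dense_iff_inter_open]
        rintro Y hY ⟨y, hy⟩
        obtain ⟨v, hv⟩ := hVne
        obtain ⟨z, ⟨hzY, hzV⟩, hzU⟩ := hUd.inter_open_nonempty
          ({z | Fin.init z ∈ Y} ∩ {z | z (Fin.last n) ∈ V})
          ((hY.preimage (f := fun z : Fin (n + 1) → X => (Fin.init z : Fin n → X))
            (by unfold Fin.init; fun_prop)).inter ((hb.isOpen hV).preimage (continuous_apply _)))
          ⟨Fin.snoc y v, by simpa using hy, by simpa using hv⟩
        exact ⟨Fin.init z, hzY, z (Fin.last n), hzV, by rwa [Fin.snoc_init_self]⟩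
    filter_upwards [h] with y hy
    refine residual_of_dense_open (hU.preimage (continuous_const.finSnoc continuous_id)) ?_
    rw [dense_iff_inter_open]
    rintro W hW ⟨w, hw⟩
    obtain ⟨V, hV, hwV, hVW⟩ := hb.exists_subset_of_mem_open hw hW
    obtain ⟨g, hg, hgU⟩ := hy V hV ⟨w, hwV⟩
    exact ⟨g, hVW hg, hgU⟩
  obtain ⟨S, hSo, hSd, hSc, hSO⟩ := mem_residual_iff.1 hO
  have h : ∀ᶠ y in residual (Fin n → X), ∀ U ∈ S,
      {g | (Fin.snoc y g : Fin (n + 1) → X) ∈ U} ∈ residual X :=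
    (eventually_countable_ball hSc).2 fun U hU => hopen U (hSo U hU) (hSd U hU)
  filter_upwards [h] with y hy
  have h2 : ∀ᶠ g in residual X, ∀ U ∈ S, (Fin.snoc y g : Fin (n + 1) → X) ∈ U :=
    (eventually_countable_ball hSc).2 hy
  filter_upwards [h2] with g hg
  exact hSO (mem_sInter.2 hg)

end Baire

/-- A bi-invariant extended metric on a topological group that is lower semicontinuous for the
topology. -/
structure IsBiinvariantMetric {G : Type*} [Group G] [TopologicalSpace G]
    (δ : G → G → ℝ≥0∞) : Prop where
  self : ∀ g, δ g g = 0
  comm : ∀ g h, δ g h = δ h g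
  triangle : ∀ g h k, δ g k ≤ δ g h + δ h k
  mul_left : ∀ k g h, δ (k * g) (k * h) = δ g h
  mul_right : ∀ k g h, δ (g * k) (h * k) = δ g h
  lsc : LowerSemicontinuous fun p : G × G => δ p.1 p.2

/-! ### Dependent choice and hereditarily generic tuples. -/

section Sequences

theorem exists_seq_of_step {S : Type*} (P : ℕ → S → Prop) (R : ℕ → S → S → Prop) {s₀ : S}
    (h₀ : P 0 s₀) (step : ∀ n s, P n s → ∃ s', P (n + 1) s' ∧ R n s s') :
    ∃ f : ℕ → S, f 0 = s₀ ∧ ∀ n, P n (f n) ∧ R n (f n) (f (n + 1)) := by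
  choose next hnext using step
  let F : (n : ℕ) → {s // P n s} := fun n =>
    Nat.rec ⟨s₀, h₀⟩ (fun n s => ⟨next n s.1 s.2, (hnext n s.1 s.2).1⟩) n
  exact ⟨fun n => (F n).1, rfl, fun n => ⟨(F n).2, (hnext n _ (F n).2).2⟩⟩

/-- A sequence of comeagre sets of tuples has comeagre subsets such that every tuple in them is
extended by almost every point. -/
theorem exists_hereditary_residual {X : Type*} [TopologicalSpace X] [SecondCountableTopology X]
    (O : ∀ n, Set (Fin n → X)) (hO : ∀ n, O n ∈ residual (Fin n → X)) :
    ∃ Q : ∀ n, Set (Fin n → X), (∀ n, Q n ⊆ O n) ∧ (∀ n, Q n ∈ residual (Fin n → X)) ∧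
      ∀ n, ∀ y ∈ Q n, ∀ᶠ g in residual X, (Fin.snoc y g : Fin (n + 1) → X) ∈ Q (n + 1) := by
  -- Each pass removes the tuples with too few extensions in the previous family; the intersection
  -- over all passes is stable under this.
  let P : ℕ → ∀ n, Set (Fin n → X) := fun k => Nat.rec O
    (fun _ P n => P n ∩ {y | ∀ᶠ g in residual X, (Fin.snoc y g : Fin (n + 1) → X) ∈ P (n + 1)}) k
  have hP : ∀ k n, P (k + 1) n =
    P k n ∩ {y | ∀ᶠ g in residual X, (Fin.snoc y g : Fin (n + 1) → X) ∈ P k (n + 1)} :=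
    fun _ _ => rfl
  refine ⟨fun n => ⋂ k, P k n, fun n => iInter_subset _ 0, fun n => ?_, fun n y hy => ?_⟩
  · refine countable_iInter_mem.2 fun k => ?_
    induction k generalizing n with
    | zero => exact hO n
    | succ k ih => exact inter_mem (ih n) (eventually_residual_snoc (ih (n + 1)))
  · simp only [mem_iInter] at hy ⊢
    refine eventually_countable_forall.2 fun k => ?_
    have := hy (k + 1)
    rw [hP] at this
    exact this.2

end Sequences

variable {G : Type*} [Group G] [TopologicalSpace G] {δ : G → G → ℝ≥0∞}

/-! ### Bi-invariant metrics and conjugation. -/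

namespace IsBiinvariantMetric

theorem inv (hδ : IsBiinvariantMetric δ) (g h : G) : δ g⁻¹ h⁻¹ = δ g h := by
  rw [← hδ.mul_left g, ← hδ.mul_right h, hδ.comm]
  simp

theorem conj (hδ : IsBiinvariantMetric δ) (k g h : G) :
    δ (k * g * k⁻¹) (k * h * k⁻¹) = δ g h := by
  rw [hδ.mul_right, hδ.mul_left]

theorem conj_left (hδ : IsBiinvariantMetric δ) (k g h : G) :
    δ (k * g * k⁻¹) h = δ g (k⁻¹ * h * k) := by
  rw [← hδ.conj k g]
  congr 1
  group

/-- Conjugation by `u` preserves `δ`, so the errors of successive conjugations add up. This is how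
two points are compared through a common conjugate. -/
theorem conj_mul (hδ : IsBiinvariantMetric δ) (u v g h k : G) :
    δ (u * v * g * (u * v)⁻¹) k ≤ δ (v * g * v⁻¹) h + δ (u * h * u⁻¹) k := by
  refine (hδ.triangle _ (u * h * u⁻¹) _).trans (add_le_add_left (le_of_eq ?_) _)
  rw [← hδ.conj u (v * g * v⁻¹) h]
  congr 1
  group

end IsBiinvariantMetric

/-! ### Ample generics and simultaneous approximate conjugation. -/

/-- In a group with ample generics, the tuples whose diagonal conjugacy classes are dense in each
other up to arbitrarily small distance are generic. -/
theorem HasAmpleGenerics.exists_residual (hδ : IsBiinvariantMetric δ)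
    (hA : HasAmpleGenerics G δ) (n : ℕ) :
    ∃ O ∈ residual (Fin n → G), ∀ y ∈ O, ∀ y' ∈ O, ∀ r : ℝ≥0∞, r ≠ 0 →
      ∃ u : G, ∀ i, δ (u * y i * u⁻¹) (y' i) < r := by
  choose x hx using fun k : ℕ => hA n (1 / ((k : ℝ) + 1)) Nat.one_div_pos_of_nat
  refine ⟨_, countable_iInter_mem.2 hx, fun y hy y' hy' r hr => ?_⟩
  obtain ⟨k, hk⟩ : ∃ k : ℕ, ENNReal.ofReal (1 / ((k : ℝ) + 1)) < r / 2 := by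
    have h : Tendsto (fun k : ℕ => ENNReal.ofReal (1 / ((k : ℝ) + 1))) atTop (𝓝 0) := by
      simpa using ENNReal.tendsto_ofReal tendsto_one_div_add_atTop_nhds_zero_nat
    exact (h.eventually_lt_const (ENNReal.half_pos hr)).exists
  obtain ⟨_, ⟨a, rfl⟩, ha⟩ := mem_iInter.1 hy k
  obtain ⟨_, ⟨b, rfl⟩, hb⟩ := mem_iInter.1 hy' k
  have ha' : ∀ i, δ (y i) (ConjAct.ofConjAct a * x k i * (ConjAct.ofConjAct a)⁻¹) < r / 2 :=
    fun i => lt_of_le_of_lt (le_iSup (fun i => δ (y i) ((a • x k) i)) i) (ha.trans hk)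
  have hb' : ∀ i, δ (y' i) (ConjAct.ofConjAct b * x k i * (ConjAct.ofConjAct b)⁻¹) < r / 2 :=
    fun i => lt_of_le_of_lt (le_iSup (fun i => δ (y' i) ((b • x k) i)) i) (hb.trans hk)
  generalize ConjAct.ofConjAct a = a at *
  generalize ConjAct.ofConjAct b = b at *
  refine ⟨b * a⁻¹, fun i => ?_⟩
  refine (hδ.conj_mul b a⁻¹ (y i) (x k i) (y' i)).trans_lt ?_
  rw [← ENNReal.add_halves r, hδ.conj_left a⁻¹, inv_inv, hδ.comm _ (y' i)]
  exact ENNReal.add_lt_add (ha' i) (hb' i)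

variable [IsTopologicalGroup G] [PolishSpace G]

/-- The set of points near some conjugate of `p` by an element of `V` almost centralizing `y`
has the Baire property. -/
theorem baireMeasurableSet_conj (hδ : IsBiinvariantMetric δ) {ι : Type*} [Countable ι]
    (y : ι → G) {V : Set G} (hV : IsOpen V) (r : ℝ≥0∞) (p : G) :
    BaireMeasurableSet {b | ∃ v ∈ V, (∀ i, δ (v * y i * v⁻¹) (y i) < r) ∧
      δ (v * p * v⁻¹) b < r} := by
  borelize G
  have hδm : Measurable fun p : G × G => δ p.1 p.2 := hδ.lsc.measurable
  have hm : MeasurableSet {q : G × G | q.1 ∈ V ∧ (∀ i, δ (q.1 * y i * q.1⁻¹) (y i) < r) ∧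
      δ (q.1 * p * q.1⁻¹) q.2 < r} := by
    have : {q : G × G | q.1 ∈ V ∧ (∀ i, δ (q.1 * y i * q.1⁻¹) (y i) < r) ∧
        δ (q.1 * p * q.1⁻¹) q.2 < r} =
        Prod.fst ⁻¹' V ∩ ((⋂ i, {q : G × G | δ (q.1 * y i * q.1⁻¹) (y i) < r}) ∩
          {q : G × G | δ (q.1 * p * q.1⁻¹) q.2 < r}) := by
      ext
      simp
    rw [this]
    refine (measurable_fst hV.measurableSet).inter ((MeasurableSet.iInter fun i => ?_).inter ?_)
    · exact measurableSet_lt (hδm.comp (f := fun q : G × G => (q.1 * y i * q.1⁻¹, y i))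
        (Continuous.measurable (by fun_prop))) measurable_const
    · exact measurableSet_lt (hδm.comp (f := fun q : G × G => (q.1 * p * q.1⁻¹, q.2))
        (Continuous.measurable (by fun_prop))) measurable_const
  convert! baireMeasurableSet_of_analyticSet (hm.analyticSet.image_of_continuous continuous_snd)
    using 1
  ext b
  simp

/-- A set of tuples in which any two are approximately conjugate, and every one of which is
extended by almost every point, allows an extension step by an almost centralizing element close
to the identity. -/
theorem exists_extension_near_one (hδ : IsBiinvariantMetric δ) {n : ℕ}
    {Q : Set (Fin (n + 1) → G)}
    (hQ : ∀ x ∈ Q, ∀ x' ∈ Q, ∀ r : ℝ≥0∞, r ≠ 0 → ∃ u : G, ∀ i, δ (u * x i * u⁻¹) (x' i) < r)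
    {y : Fin n → G} (hy : ∀ᶠ g in residual G, (Fin.snoc y g : Fin (n + 1) → G) ∈ Q)
    {N : Set G} (hN : N ∈ 𝓝 1) {A B : Set G} (hA : ¬ IsMeagre A)
    (hB : ∀ U : Set G, IsOpen U → U.Nonempty → ¬ IsMeagre (U ∩ B)) {r : ℝ≥0∞} (hr : r ≠ 0) :
    ∃ g ∈ A, ∃ v ∈ N, ∃ b ∈ B, (Fin.snoc y g : Fin (n + 1) → G) ∈ Q ∧
      (∀ i, δ (v * y i * v⁻¹) (y i) < r) ∧ δ (v * g * v⁻¹) b < r := by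
  obtain ⟨V, hVo, hV1, hVN⟩ : ∃ V : Set G, IsOpen V ∧ (1 : G) ∈ V ∧
      ∀ v ∈ V, ∀ w ∈ V, v * w⁻¹ ∈ N := by
    obtain ⟨V, hV, hVN⟩ := exists_nhds_split_inv hN
    obtain ⟨V', hV', hV'o, h1⟩ := mem_nhds_iff.1 hV
    refine ⟨V', hV'o, h1, fun v hv w hw => ?_⟩
    simpa [div_eq_mul_inv] using hVN v (hV' hv) w (hV' hw)
  -- Two errors of `s` combine to `r / 2` in the covering by the sets `S`, and two errors of `r / 2`
  -- combine to `r` at the end.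
  set s := r / 2 / 2
  have hs2 : s + s = r / 2 := ENNReal.add_halves _
  have hs0 : s ≠ 0 := by simp [s, hr]
  obtain ⟨g₀, hg₀⟩ : ∃ g₀, (Fin.snoc y g₀ : Fin (n + 1) → G) ∈ Q :=
    (dense_of_mem_residual hy).nonempty
  set K : Set G := {u | ∀ i, δ (u * y i * u⁻¹) (y i) < s} with hK
  obtain ⟨c, hc, hcd⟩ := TopologicalSpace.exists_countable_dense K
  let S : G → Set G := fun p => {b | ∃ v ∈ V, (∀ i, δ (v * y i * v⁻¹) (y i) < r / 2) ∧
      δ (v * p * v⁻¹) b < r / 2}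
  -- Separability of the approximate centralizer `K` lets each `w` in `K` be written as an element
  -- of `V` times some `u ∈ c`. Hence countably many sets `S` cover all extensions of `y` in `Q`.
  have hcover : ∀ g, (Fin.snoc y g : Fin (n + 1) → G) ∈ Q →
      ∃ u ∈ c, g ∈ S ((u : G) * g₀ * (u : G)⁻¹) := by
    intro g hg
    obtain ⟨w, hw⟩ := hQ _ hg₀ _ hg s hs0
    have hwK : w ∈ K := fun i => by simpa using hw i.castSucc
    have hwg : δ (w * g₀ * w⁻¹) g < s := by simpa using hw (Fin.last n)
    obtain ⟨u, huc, hu⟩ : ∃ u ∈ c, w * (u : G)⁻¹ ∈ V := by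
      have ho : IsOpen {u : K | w * (u : G)⁻¹ ∈ V} := hVo.preimage (by fun_prop)
      obtain ⟨u, hu, huc⟩ := hcd.inter_open_nonempty _ ho ⟨⟨w, hwK⟩, by simpa using hV1⟩
      exact ⟨u, huc, hu⟩
    refine ⟨u, huc, w * (u : G)⁻¹, hu, fun i => ?_, ?_⟩
    · refine (hδ.conj_mul w (u : G)⁻¹ (y i) (y i) (y i)).trans_lt ?_
      rw [← hs2, hδ.conj_left (u : G)⁻¹, inv_inv, hδ.comm (y i)]
      exact ENNReal.add_lt_add (u.2 i) (hwK i)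
    · have : w * (u : G)⁻¹ * ((u : G) * g₀ * (u : G)⁻¹) * (w * (u : G)⁻¹)⁻¹ = w * g₀ * w⁻¹ := by
        group
      rw [this]
      exact hwg.trans_le (hs2 ▸ le_self_add)
  obtain ⟨u, -, hu⟩ : ∃ u ∈ c, ¬ IsMeagre (A ∩ {g | (Fin.snoc y g : Fin (n + 1) → G) ∈ Q} ∩
      S ((u : G) * g₀ * (u : G)⁻¹)) := by
    by_contra! h
    apply hA
    refine ((isMeagre_biUnion hc h).union (t := {g | (Fin.snoc y g : Fin (n + 1) → G) ∈ Q}ᶜ)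
      (by rwa [IsMeagre, compl_compl])).mono fun g hg => ?_
    by_cases hgQ : (Fin.snoc y g : Fin (n + 1) → G) ∈ Q
    · obtain ⟨u, hu, hgu⟩ := hcover g hgQ
      exact Or.inl (mem_iUnion₂.2 ⟨u, hu, And.intro (And.intro hg hgQ) hgu⟩)
    · exact Or.inr hgQ
  obtain ⟨g, ⟨hgA, hgQ⟩, v, hv, hvy, hvg⟩ := nonempty_of_not_isMeagre hu
  -- The chosen `S` is comeagre in some open set, so it meets `B` as well as `A`. Going from `g`
  -- back to the centre by `v⁻¹` and on to `b` by `w` gives the required `w * v⁻¹`.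
  obtain ⟨U, hUo, hUne, hUS⟩ := exists_isOpen_isMeagre_diff
    (baireMeasurableSet_conj hδ y hVo (r / 2) ((u : G) * g₀ * (u : G)⁻¹))
    (fun h => hu (h.mono inter_subset_right))
  obtain ⟨b, hbB, w, hw, hwy, hwb⟩ : (B ∩ S ((u : G) * g₀ * (u : G)⁻¹)).Nonempty := by
    by_contra h
    refine hB U hUo hUne (hUS.mono ?_)
    rintro b ⟨hbU, hbB⟩
    exact ⟨hbU, fun hbS => h ⟨b, hbB, hbS⟩⟩
  refine ⟨g, hgA, w * v⁻¹, hVN w hw v hv, b, hbB, hgQ, fun i => ?_, ?_⟩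
  · refine (hδ.conj_mul w v⁻¹ (y i) (y i) (y i)).trans_lt ?_
    rw [← ENNReal.add_halves r, hδ.conj_left v⁻¹, inv_inv, hδ.comm (y i)]
    exact ENNReal.add_lt_add (hvy i) (hwy i)
  · refine (hδ.conj_mul w v⁻¹ g ((u : G) * g₀ * (u : G)⁻¹) b).trans_lt ?_
    rw [← ENNReal.add_halves r, hδ.conj_left v⁻¹, inv_inv, hδ.comm g]
    exact ENNReal.add_lt_add hvg hwb

/-- The extension step of `exists_extension_near_one`, translated by a group element `h`. -/
theorem exists_extension_near (hδ : IsBiinvariantMetric δ) {n : ℕ}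
    {Q : Set (Fin (n + 1) → G)}
    (hQ : ∀ x ∈ Q, ∀ x' ∈ Q, ∀ r : ℝ≥0∞, r ≠ 0 → ∃ u : G, ∀ i, δ (u * x i * u⁻¹) (x' i) < r)
    {y : Fin n → G} (hy : ∀ᶠ g in residual G, (Fin.snoc y g : Fin (n + 1) → G) ∈ Q)
    (h : G) {N : Set G} (hN : N ∈ 𝓝 h) {A B : Set G} (hA : ¬ IsMeagre A)
    (hB : ∀ U : Set G, IsOpen U → U.Nonempty → ¬ IsMeagre (U ∩ B)) {r : ℝ≥0∞} (hr : r ≠ 0) :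
    ∃ g ∈ A, ∃ k ∈ N, ∃ b ∈ B, (Fin.snoc y g : Fin (n + 1) → G) ∈ Q ∧
      (∀ i, δ (k * y i * k⁻¹) (h * y i * h⁻¹) < r) ∧ δ (k * g * k⁻¹) b < r := by
  have hN' : (fun v => h * v) ⁻¹' N ∈ 𝓝 (1 : G) :=
    (continuous_const_mul h).continuousAt.preimage_mem_nhds (by simpa using hN)
  have hB' : ∀ U : Set G, IsOpen U → U.Nonempty → ¬ IsMeagre (U ∩ {b | h * b * h⁻¹ ∈ B}) := by
    intro U hU hUne hm
    let c : G ≃ₜ G := (Homeomorph.mulLeft h⁻¹).trans (Homeomorph.mulRight h)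
    have hc : ∀ x, c x = h⁻¹ * x * h := fun x => rfl
    refine hB (c ⁻¹' U) (hU.preimage c.continuous) (hUne.preimage c.surjective) ?_
    refine (hm.preimage_of_isOpenMap c.continuous c.isOpenMap).mono ?_
    rintro x ⟨hxU, hxB⟩
    refine ⟨hxU, ?_⟩
    have : h * c x * h⁻¹ = x := by rw [hc]; group
    rw [mem_ofPred_eq, this]
    exact hxB
  obtain ⟨g, hg, v, hv, b, hb, hgQ, hvy, hvg⟩ := exists_extension_near_one hδ hQ hy hN' hA hB' hr
  refine ⟨g, hg, h * v, hv, _, hb, hgQ, fun i => ?_, ?_⟩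
  · have : h * v * y i * (h * v)⁻¹ = h * (v * y i * v⁻¹) * h⁻¹ := by group
    rw [this, hδ.conj]
    exact hvy i
  · have : h * v * g * (h * v)⁻¹ = h * (v * g * v⁻¹) * h⁻¹ := by group
    rw [this, hδ.conj]
    exact hvg

/-- In a Polish group with ample generics, one element conjugates, up to `ε`, a sequence of
elements of given nonmeagre sets into given everywhere nonmeagre sets. -/
theorem HasAmpleGenerics.exists_conj_seq (hδ : IsBiinvariantMetric δ)
    (hG : HasAmpleGenerics G δ) {A B : ℕ → Set G} (hA : ∀ k, ¬ IsMeagre (A k))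
    (hB : ∀ k, ∀ U : Set G, IsOpen U → U.Nonempty → ¬ IsMeagre (U ∩ B k))
    {ε : ℝ≥0∞} (hε : ε ≠ 0) :
    ∃ h : G, ∀ k, ∃ y ∈ A k, ∃ z ∈ B k, δ (h * y * h⁻¹) z ≤ ε := by
  choose O hO hOconj using hG.exists_residual hδ
  obtain ⟨Q, hQO, hQ, hQext⟩ := exists_hereditary_residual O hO
  -- A state is `(y, z, h)`, of which only the first `n` entries of `y` and `z` matter at stage `n`.
  -- The geometric bound in `R` makes the third components converge.
  let _ := TopologicalSpace.upgradeIsCompletelyMetrizable G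
  let P : ℕ → (ℕ → G) × (ℕ → G) × G → Prop := fun n s =>
    (fun i : Fin n => s.1 i) ∈ Q n ∧ ∀ i < n, δ (s.2.2 * s.1 i * s.2.2⁻¹) (s.2.1 i) < ε
  let R : ℕ → (ℕ → G) × (ℕ → G) × G → (ℕ → G) × (ℕ → G) × G → Prop := fun n s s' =>
    (∀ i < n, s'.1 i = s.1 i) ∧ (∀ i < n, s'.2.1 i = s.2.1 i) ∧ s'.1 n ∈ A n ∧ s'.2.1 n ∈ B n ∧
      dist s.2.2 s'.2.2 ≤ 1 / 2 / 2 ^ n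
  have h₀ : P 0 (1, 1, 1) := by
    refine ⟨?_, fun i hi => absurd hi (Nat.not_lt_zero i)⟩
    obtain ⟨q, hq⟩ := (dense_of_mem_residual (hQ 0)).nonempty
    convert! hq
  have step : ∀ n s, P n s → ∃ s', P (n + 1) s' ∧ R n s s' := by
    rintro n ⟨y, z, h⟩ ⟨hy, hyz⟩
    -- The finitely many earlier inequalities are strict, so a common slack `r` can be spent on
    -- moving `h`.
    obtain ⟨r, hr0, hrε, hr⟩ : ∃ r : ℝ≥0∞, r ≠ 0 ∧ r ≤ ε ∧
        ∀ i : Fin n, r + δ (h * y i * h⁻¹) (z i) < ε := by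
      have h1 : ∀ i : Fin n, ∃ r : ℝ≥0∞, 0 < r ∧ r + δ (h * y i * h⁻¹) (z i) < ε := by
        intro i
        obtain ⟨r, hr, hlt⟩ := ENNReal.lt_iff_exists_add_pos_lt.1 (hyz i i.2)
        exact ⟨r, by simpa using hr, by rwa [add_comm]⟩
      choose r hr hrlt using h1
      refine ⟨ε ⊓ Finset.univ.inf r, ?_, inf_le_left, fun i => ?_⟩
      · refine (lt_inf_iff.2 ⟨pos_iff_ne_zero.2 hε, ?_⟩).ne'
        exact (Finset.lt_inf_iff (by simp)).2 fun i _ => hr i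
      · refine (add_le_add_left ?_ _).trans_lt (hrlt i)
        exact inf_le_right.trans (Finset.inf_le (Finset.mem_univ i))
    obtain ⟨g, hg, k, hk, b, hb, hgQ, hky, hkg⟩ := exists_extension_near hδ
      (fun x hx x' hx' => hOconj (n + 1) x (hQO _ hx) x' (hQO _ hx')) (hQext n _ hy) h
      (Metric.closedBall_mem_nhds h (show (0 : ℝ) < 1 / 2 / 2 ^ n by positivity))
      (hA n) (hB n) hr0
    have hlt : ∀ {α : Type _} (f : ℕ → α) (a : α) (i), i < n → Function.update f n a i = f i :=
      fun f a i hi => Function.update_of_ne hi.ne _ _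
    refine ⟨(Function.update y n g, Function.update z n b, k), ⟨?_, fun i hi => ?_⟩,
      hlt y g, hlt z b, by simpa using hg, by simpa using hb, by simpa [dist_comm] using hk⟩
    · convert! hgQ using 1
      funext i
      refine Fin.lastCases ?_ (fun i => ?_) i
      · simp
      · simp [hlt y g i i.2]
    · rcases Nat.lt_succ_iff_lt_or_eq.1 hi with hi | rfl
      · simp only [hlt y g i hi, hlt z b i hi]
        refine (hδ.triangle _ (h * y i * h⁻¹) _).trans_lt (lt_of_le_of_lt ?_ (hr ⟨i, hi⟩))
        exact add_le_add_left (hky ⟨i, hi⟩).le _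
      · simpa using hkg.trans_le hrε
  obtain ⟨f, -, hf⟩ := exists_seq_of_step P R h₀ step
  -- Entry `k` is set in passing from stage `k` to `k + 1` and is frozen afterwards.
  have hstable : ∀ k n, k < n →
      (f n).1 k = (f (k + 1)).1 k ∧ (f n).2.1 k = (f (k + 1)).2.1 k := by
    intro k n hkn
    induction n, hkn using Nat.le_induction with
    | base => exact ⟨rfl, rfl⟩
    | succ n hn ih =>
      exact ⟨((hf n).2.1 k hn).trans ih.1, ((hf n).2.2.1 k hn).trans ih.2⟩
  obtain ⟨h, hh⟩ := cauchySeq_tendsto_of_complete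
    (cauchySeq_of_le_geometric_two fun n => (hf n).2.2.2.2.2)
  refine ⟨h, fun k => ⟨_, (hf k).2.2.2.1, _, (hf k).2.2.2.2.1, ?_⟩⟩
  -- By lower semicontinuity the strict bounds survive in the limit as `≤ ε`.
  have hcl : IsClosed {p : G × G | δ p.1 p.2 ≤ ε} := hδ.lsc.isClosed_preimage ε
  have hlim : Tendsto (fun n => ((f n).2.2 * (f (k + 1)).1 k * ((f n).2.2)⁻¹,
      (f (k + 1)).2.1 k)) atTop (𝓝 (h * (f (k + 1)).1 k * h⁻¹, (f (k + 1)).2.1 k)) :=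
    ((hh.mul_const _).mul hh.inv).prodMk_nhds tendsto_const_nhds
  refine hcl.mem_of_tendsto hlim ?_
  filter_upwards [eventually_gt_atTop k] with n hn
  have := (hf n).1.2 k hn
  rw [(hstable k n hn).1, (hstable k n hn).2] at this
  exact this.le

/-! ### Pettis's lemma, enlargements and the sixth power. -/

/-- Pettis: the difference set of a set comeagre in a nonempty open set is a neighbourhood of
the identity. -/
theorem mul_inv_mem_nhds_one {U C : Set G} (hU : IsOpen U) (hUne : U.Nonempty)
    (hUC : IsMeagre (U \ C)) : C * C⁻¹ ∈ 𝓝 1 := by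
  obtain ⟨u, hu⟩ := hUne
  have hN : (fun g : G => g⁻¹ * u) ⁻¹' U ∈ 𝓝 (1 : G) :=
    (hU.preimage (by fun_prop)).mem_nhds (by simpa using hu)
  filter_upwards [hN] with g hg
  by_contra hgC
  let c : G ≃ₜ G := Homeomorph.mulLeft g⁻¹
  -- If `g ∉ C * C⁻¹`, then `C` and its translate by `g` are disjoint, though both are comeagre in
  -- the nonempty open set `U ∩ c ⁻¹' U`.
  refine not_isMeagre_of_isOpen (hU.inter (hU.preimage c.continuous)) ⟨u, hu, hg⟩ ?_
  refine (hUC.union (hUC.preimage_of_isOpenMap c.continuous c.isOpenMap)).mono ?_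
  rintro x ⟨hx, hxc⟩
  by_contra h
  simp only [mem_union, Set.mem_sdiff, mem_preimage, not_or, not_and, not_not] at h
  refine hgC ⟨x, h.1 hx, (c x)⁻¹, Set.inv_mem_inv.2 (h.2 hxc), ?_⟩
  simp [c]

section Enlarge

variable {G : Type*} [Group G] [TopologicalSpace G] {δ : G → G → ℝ≥0∞}

theorem IsBiinvariantMetric.subset_enlarge (hδ : IsBiinvariantMetric δ) (W : Set G) {ε : ℝ}
    (hε : 0 < ε) : W ⊆ enlarge δ W ε :=
  fun g hg => ⟨g, hg, by simpa [hδ.self] using hε⟩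

theorem IsBiinvariantMetric.enlarge_inv (hδ : IsBiinvariantMetric δ) {W : Set G} (hW : W⁻¹ = W)
    (ε : ℝ) : (enlarge δ W ε)⁻¹ = enlarge δ W ε := by
  have h : ∀ g ∈ enlarge δ W ε, g⁻¹ ∈ enlarge δ W ε := by
    rintro g ⟨w, hw, hgw⟩
    exact ⟨w⁻¹, by rwa [← Set.mem_inv, hW], by rwa [hδ.inv]⟩
  ext g
  exact ⟨fun hg => by simpa using h _ hg, fun hg => h _ hg⟩

/-- By right invariance the whole error can be moved into the first factor, so a triple product
needs only one enlarged factor. -/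
theorem IsBiinvariantMetric.enlarge_mul_subset (hδ : IsBiinvariantMetric δ) (A B : Set G) (ε : ℝ) :
    enlarge δ (A * B) ε ⊆ enlarge δ A ε * B := by
  rintro g ⟨_, ⟨a, ha, b, hb, rfl⟩, h⟩
  refine ⟨g * b⁻¹, ⟨a, ha, ?_⟩, b, hb, by simp⟩
  rw [← hδ.mul_right b]
  simpa using h

end Enlarge

/-- In a Polish group with ample generics, for every increasing exhaustive sequence of symmetric
sets some sixth power of an enlargement is a neighbourhood of the identity. -/
theorem HasAmpleGenerics.exists_enlarge_pow_mem_nhds_one (hδ : IsBiinvariantMetric δ)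
    (hG : HasAmpleGenerics G δ) {W : ℕ → Set G} (hW : Monotone W) (hWu : ⋃ n, W n = univ)
    (hWi : ∀ n, (W n)⁻¹ = W n) {ε : ℝ} (hε : 0 < ε) :
    ∃ n, enlarge δ (W n) ε ^ 6 ∈ 𝓝 (1 : G) := by
  obtain ⟨k₀, hk₀⟩ : ∃ k, ¬ IsMeagre (W k) := by
    by_contra! h
    refine not_isMeagre_of_isOpen (isOpen_univ (X := G)) univ_nonempty ?_
    exact hWu ▸ isMeagre_iUnion h
  obtain ⟨n, U, hU, hUne, hUm⟩ : ∃ n, ∃ U : Set G, IsOpen U ∧ U.Nonempty ∧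
      IsMeagre (U ∩ (enlarge δ (W n * W n * W n) ε)ᶜ) := by
    by_contra! hB
    -- The shift by `k₀` makes every `W (k + k₀)` nonmeagre. The radius `ε / 2` turns the non-strict
    -- bound into the strict one in `enlarge`.
    obtain ⟨h, hh⟩ := hG.exists_conj_seq hδ (A := fun k => W (k + k₀))
      (B := fun k => (enlarge δ (W (k + k₀) * W (k + k₀) * W (k + k₀)) ε)ᶜ)
      (fun k hk => hk₀ (hk.mono (hW (Nat.le_add_left _ _)))) (fun k => hB (k + k₀))
      (ε := ENNReal.ofReal (ε / 2)) (by simpa using hε)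
    obtain ⟨k, hk⟩ := mem_iUnion.1 (hWu ▸ mem_univ h : h ∈ ⋃ n, W n)
    have hk' : h ∈ W (k + k₀) := hW (Nat.le_add_right _ _) hk
    obtain ⟨y, hy, z, hz, hyz⟩ := hh k
    refine hz ⟨h * y * h⁻¹, mul_mem_mul (mul_mem_mul hk' hy) ?_, ?_⟩
    · rw [← hWi]
      exact Set.inv_mem_inv.2 hk'
    · rw [hδ.comm]
      exact hyz.trans_lt ((ENNReal.ofReal_lt_ofReal_iff hε).2 (half_lt_self hε))
  refine ⟨n, mem_of_superset (mul_inv_mem_nhds_one hU hUne hUm) ?_⟩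
  set E := enlarge δ (W n) ε
  have hWE : W n ⊆ E := hδ.subset_enlarge _ hε
  have hC : enlarge δ (W n * W n * W n) ε ⊆ E ^ 3 := by
    rw [pow_succ, pow_two, mul_assoc, mul_assoc]
    exact (hδ.enlarge_mul_subset _ _ _).trans (mul_subset_mul_left (mul_subset_mul hWE hWE))
  have hCi : (enlarge δ (W n * W n * W n) ε)⁻¹ ⊆ E ^ 3 := by
    have hE : E⁻¹ = E := hδ.enlarge_inv (hWi n) ε
    rw [← hE, inv_pow]
    exact inv_subset_inv.2 hC
  exact (mul_subset_mul hC hCi).trans_eq (pow_add E 3 3).symm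

/-! ### Isometry groups: Polishness and the uniform metric. -/

section Isometries

variable {X : Type*} [MetricSpace X]

theorem tendsto_isometryEquiv_iff {ι : Type*} {l : Filter ι} {F : ι → X ≃ᵢ X} {g : X ≃ᵢ X} :
    Tendsto F l (𝓝 g) ↔ ∀ x, Tendsto (fun i => F i x) l (𝓝 (g x)) := by
  rw [(show IsInducing (fun g : X ≃ᵢ X => (g : X → X)) from ⟨rfl⟩).tendsto_nhds_iff,
    tendsto_pi_nhds]
  rfl

theorem continuous_isometryEquiv_apply (x : X) : Continuous fun g : X ≃ᵢ X => g x :=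
  (continuous_apply x).comp continuous_induced_dom

instance isoIsTopologicalGroup : IsTopologicalGroup (X ≃ᵢ X) where
  continuous_mul := by
    refine continuous_iff_continuousAt.2 fun p => tendsto_isometryEquiv_iff.2 fun x => ?_
    rw [tendsto_iff_dist_tendsto_zero]
    have h1 : Tendsto (fun q : (X ≃ᵢ X) × (X ≃ᵢ X) => dist (q.2 x) (p.2 x)) (𝓝 p) (𝓝 0) :=
      tendsto_iff_dist_tendsto_zero.1
        (((continuous_isometryEquiv_apply x).comp continuous_snd).tendsto p)
    have h2 : Tendsto (fun q : (X ≃ᵢ X) × (X ≃ᵢ X) => dist (q.1 (p.2 x)) (p.1 (p.2 x)))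
        (𝓝 p) (𝓝 0) :=
      tendsto_iff_dist_tendsto_zero.1
        (((continuous_isometryEquiv_apply (p.2 x)).comp continuous_fst).tendsto p)
    refine squeeze_zero (fun _ => dist_nonneg) (fun q => ?_) (by simpa using h1.add h2)
    refine (dist_triangle _ (q.1 (p.2 x)) _).trans_eq ?_
    rw [← q.1.isometry.dist_eq (q.2 x)]
    rfl
  continuous_inv := by
    refine continuous_iff_continuousAt.2 fun g => tendsto_isometryEquiv_iff.2 fun x => ?_
    rw [tendsto_iff_dist_tendsto_zero]
    have h := tendsto_iff_dist_tendsto_zero.1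
      ((continuous_isometryEquiv_apply (g⁻¹ x)).tendsto g)
    refine h.congr fun k => ?_
    rw [← k.isometry.dist_eq (k⁻¹ x), dist_comm]
    congr 1
    exact (g.apply_symm_apply x).trans (k.apply_symm_apply x).symm

theorem tendsto_isometryEquiv_of_dense {D : Set X} (hD : Dense D) {ι : Type*} {l : Filter ι}
    {F : ι → X ≃ᵢ X} {g : X ≃ᵢ X} (h : ∀ d ∈ D, Tendsto (fun i => F i d) l (𝓝 (g d))) :
    Tendsto F l (𝓝 g) := by
  refine tendsto_isometryEquiv_iff.2 fun x => Metric.tendsto_nhds.2 fun ε hε => ?_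
  obtain ⟨d, hd, hxd⟩ := hD.exists_dist_lt x (show 0 < ε / 3 by positivity)
  filter_upwards [Metric.tendsto_nhds.1 (h d hd) (ε / 3) (by positivity)] with i hi
  have h1 := (F i).isometry.dist_eq x d
  have h2 := g.isometry.dist_eq d x
  rw [dist_comm d x] at h2
  have := dist_triangle4 (F i x) (F i d) (g d) (g x)
  linarith

theorem exists_tendsto_isometryEquiv_of_dense [CompleteSpace X] {D : Set X} (hD : Dense D)
    {F : ℕ → X ≃ᵢ X} (h : ∀ d ∈ D, ∃ y, Tendsto (fun n => F n d) atTop (𝓝 y)) (x : X) :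
    ∃ y, Tendsto (fun n => F n x) atTop (𝓝 y) := by
  refine cauchySeq_tendsto_of_complete (Metric.cauchySeq_iff.2 fun ε hε => ?_)
  obtain ⟨d, hd, hxd⟩ := hD.exists_dist_lt x (show 0 < ε / 3 by positivity)
  obtain ⟨y, hy⟩ := h d hd
  obtain ⟨N, hN⟩ := Metric.cauchySeq_iff.1 hy.cauchySeq (ε / 3) (by positivity)
  refine ⟨N, fun m hm n hn => ?_⟩
  have h0 := hN m hm n hn
  have h1 := (F m).isometry.dist_eq x d
  have h2 := (F n).isometry.dist_eq d x
  rw [dist_comm d x] at h2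
  have := dist_triangle4 (F m x) (F m d) (F n d) (F n x)
  linarith

/-- The isometry group of a Polish metric space is Polish. -/
theorem polishSpace_isometryEquiv [CompleteSpace X] [TopologicalSpace.SeparableSpace X] :
    PolishSpace (X ≃ᵢ X) := by
  have : SecondCountableTopology X := UniformSpace.secondCountable_of_separable X
  obtain ⟨D, hDc, hD⟩ := TopologicalSpace.exists_countable_dense X
  have : Countable D := hDc
  -- Recording `g⁻¹` along with `g` closes the range: a limit of isometries alone may fail to be
  -- surjective.
  let Φ : (X ≃ᵢ X) → (D → X) × (D → X) := fun g => (fun d => g d, fun d => g⁻¹ d)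
  have hΦ : Continuous Φ := by
    refine (continuous_pi fun d => continuous_isometryEquiv_apply _).prodMk
      (continuous_pi fun d => (continuous_isometryEquiv_apply _).comp continuous_inv)
  have hind : IsInducing Φ := by
    refine isInducing_iff_nhds.2 fun g => le_antisymm (hΦ.tendsto g).le_comap ?_
    refine tendsto_id'.1 (tendsto_isometryEquiv_of_dense hD fun d hd => ?_)
    exact ((continuous_apply (⟨d, hd⟩ : D)).comp continuous_fst).continuousAt.tendsto.comp
      (tendsto_comap (f := Φ))
  have hinj : Function.Injective Φ := by
    intro g k hgk
    have : (g : X → X) = k := g.continuous.ext_on hD k.continuous fun d hd =>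
      congrFun (congrArg Prod.fst hgk) ⟨d, hd⟩
    exact DFunLike.coe_injective this
  have hcl : IsClosed (range Φ) := by
    refine isClosed_of_closure_subset fun p hp => ?_
    obtain ⟨q, hq, hqp⟩ := mem_closure_iff_seq_limit.1 hp
    choose g hg using hq
    obtain rfl : (fun n => Φ (g n)) = q := funext hg
    rw [Prod.tendsto_iff, tendsto_pi_nhds, tendsto_pi_nhds] at hqp
    choose a ha using exists_tendsto_isometryEquiv_of_dense hD (F := g)
      fun d hd => ⟨_, hqp.1 ⟨d, hd⟩⟩
    choose b hb using exists_tendsto_isometryEquiv_of_dense hD (F := fun n => (g n)⁻¹)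
      fun d hd => ⟨_, hqp.2 ⟨d, hd⟩⟩
    have hba : ∀ x, b (a x) = x := by
      intro x
      refine tendsto_nhds_unique (hb (a x)) (tendsto_iff_dist_tendsto_zero.2 ?_)
      refine (tendsto_iff_dist_tendsto_zero.1 (ha x)).congr fun n => ?_
      rw [← (g n).isometry.dist_eq _ x, dist_comm]
      congr 1
      exact ((g n).apply_symm_apply (a x)).symm
    have hab : ∀ x, a (b x) = x := by
      intro x
      refine tendsto_nhds_unique (ha (b x)) (tendsto_iff_dist_tendsto_zero.2 ?_)
      refine (tendsto_iff_dist_tendsto_zero.1 (hb x)).congr fun n => ?_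
      rw [← (g n).isometry.dist_eq _ (b x), dist_comm]
      congr 1
      exact (g n).apply_symm_apply x
    have hiso : Isometry a := by
      refine Isometry.of_dist_eq fun x y => ?_
      refine tendsto_nhds_unique ((ha x).dist (ha y)) ?_
      simp only [(g _).isometry.dist_eq]
      exact tendsto_const_nhds
    refine ⟨⟨⟨a, b, hba, hab⟩, hiso⟩, Prod.ext (funext fun d => ?_) (funext fun d => ?_)⟩
    · exact tendsto_nhds_unique (ha d) (hqp.1 d)
    · exact tendsto_nhds_unique (hb d) (hqp.2 d)
  exact (IsClosedEmbedding.mk ⟨hind, hinj⟩ hcl).polishSpace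

/-- Right translation reparametrizes the supremum over `X`; lower semicontinuity holds because each
evaluation distance is continuous. -/
theorem isBiinvariantMetric_uniformDist (G : Subgroup (X ≃ᵢ X)) :
    IsBiinvariantMetric (uniformDist (X := X) G) where
  self g := by simp [uniformDist]
  comm g h := by simp [uniformDist, edist_comm]
  triangle g h k := iSup_le fun x => (edist_triangle _ (h • x) _).trans
    (add_le_add (le_iSup (fun x => edist (g • x) (h • x)) x)
      (le_iSup (fun x => edist (h • x) (k • x)) x))
  mul_left k g h := by simp [uniformDist, mul_smul]
  mul_right k g h := by
    simp only [uniformDist, mul_smul]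
    exact (MulAction.toPerm k : Equiv.Perm X).iSup_comp (g := fun x => edist (g • x) (h • x))
  lsc := by
    refine lowerSemicontinuous_iSup fun x => Continuous.lowerSemicontinuous ?_
    have h : Continuous fun g : G => g • x :=
      (continuous_isometryEquiv_apply x).comp continuous_subtype_val
    exact (h.comp continuous_fst).edist (h.comp continuous_snd)

/-- Neighbourhoods of the identity contain approximate stabilizers of finite tuples. -/
theorem exists_approx_stabilizer_subset (G : Subgroup (X ≃ᵢ X)) {N : Set G} (hN : N ∈ 𝓝 1) :
    ∃ (m : ℕ) (a : Fin m → X) (η : ℝ), 0 < η ∧ ∀ g : G, (∀ i, dist (g • a i) (a i) < η) →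
      g ∈ N := by
  have hind : IsInducing (fun (g : G) (x : X) => g • x) :=
    (show IsInducing (fun g : X ≃ᵢ X => (g : X → X)) from ⟨rfl⟩).comp IsInducing.subtypeVal
  rw [hind.nhds_eq_comap, nhds_pi] at hN
  obtain ⟨S, hS, hSN⟩ := hN
  obtain ⟨I, t, ht, hIS⟩ := Filter.mem_pi'.1 hS
  choose r hr hrt using fun x => Metric.mem_nhds_iff.1 (ht x)
  obtain ⟨η, hη, hηr⟩ : ∃ η : ℝ, 0 < η ∧ ∀ x ∈ I, η ≤ r x := by
    have h : ∀ᶠ η in 𝓝[>] (0 : ℝ), ∀ x ∈ I, η ≤ r x :=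
      (Filter.eventually_all_finset I).2 fun x _ =>
        (eventually_le_nhds (hr x)).filter_mono nhdsWithin_le_nhds
    obtain ⟨η, h, hη⟩ := (h.and self_mem_nhdsWithin).exists
    exact ⟨η, hη, h⟩
  refine ⟨I.card, fun i => I.equivFin.symm i, η, hη, fun g hg => hSN (hIS fun x hx => hrt x ?_)⟩
  have := hg (I.equivFin ⟨x, hx⟩)
  simp only [Equiv.symm_apply_apply] at this
  simpa using this.trans_le (hηr x hx)

end Isometries

/-! ### Finitely many double cosets, and the conclusion. -/

/-- An approximately oligomorphic isometric action is Roelcke precompact with respect to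
approximate stabilizers of finite tuples. -/
theorem ApproximatelyOligomorphic.exists_finite_double_cosets {G M : Type*} [Group G]
    [MetricSpace M] [MulAction G M] [IsIsometricSMul G M] (hO : ApproximatelyOligomorphic G M)
    {m : ℕ} (a : Fin m → M) {η : ℝ} (hη : 0 < η) :
    ∃ F : Set G, F.Finite ∧ ∀ g : G, ∃ v w, ∃ f ∈ F, g = v * f * w ∧
      (∀ i, dist (v • a i) (a i) < η) ∧ ∀ i, dist (w • a i) (a i) < η := by
  obtain ⟨B, hB⟩ := hO (m + m) (η / 3) (by positivity)
  let C : (Fin (m + m) → M) → G → Prop := fun b g =>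
    ∃ h : G, dist (h • b) (Fin.append a (g • a)) ≤ η / 3
  have hC : ∀ b, ∃ f, ∀ g, C b g → C b f := by
    intro b
    by_cases h : ∃ g, C b g
    · exact ⟨h.choose, fun _ _ => h.choose_spec⟩
    · exact ⟨1, fun g hg => (h ⟨g, hg⟩).elim⟩
  choose f hf using hC
  refine ⟨f '' B, B.finite_toSet.image f, fun g => ?_⟩
  obtain ⟨b, hb, h, hh⟩ := hB (Fin.append a (g • a))
  obtain ⟨k, hk⟩ := hf b g ⟨h, hh⟩
  have hsplit : ∀ {u g' : G}, dist (u • b) (Fin.append a (g' • a)) ≤ η / 3 → ∀ i,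
      dist (u • b (Fin.castAdd m i)) (a i) ≤ η / 3 ∧
        dist (u • b (Fin.natAdd m i)) (g' • a i) ≤ η / 3 := by
    intro u g' hu i
    have h1 := (dist_le_pi_dist _ _ (Fin.castAdd m i)).trans hu
    have h2 := (dist_le_pi_dist _ _ (Fin.natAdd m i)).trans hu
    rw [Fin.append_left] at h1
    rw [Fin.append_right] at h2
    exact ⟨h1, h2⟩
  have hmove : ∀ (x y z : M), dist (h • x) y ≤ η / 3 → dist (k • x) z ≤ η / 3 →
      dist ((h * k⁻¹) • z) y < η := by
    intro x y z hx hz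
    have h1 : dist ((h * k⁻¹) • z) (h • x) = dist (k • x) z := by
      rw [mul_smul, dist_smul, ← dist_smul k, smul_inv_smul, dist_comm]
    have := dist_triangle ((h * k⁻¹) • z) (h • x) y
    linarith
  -- With `v = h * k⁻¹`, both `v • a` is near `a` and `(v * f b) • a` is near `g • a`, as each pair
  -- is compared through `b`. Hence `(v * f b)⁻¹ * g` also nearly fixes `a`.
  refine ⟨h * k⁻¹, (f b)⁻¹ * (h * k⁻¹)⁻¹ * g, f b, mem_image_of_mem _ hb, by group,
    fun i => hmove _ _ _ (hsplit hh i).1 (hsplit hk i).1, fun i => ?_⟩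
  have := hmove _ _ _ (hsplit hh i).2 (hsplit hk i).2
  rw [← dist_smul ((h * k⁻¹) * f b), dist_comm]
  rw [← mul_smul] at this
  convert! this using 2
  rw [← mul_smul]
  congr 1
  group

theorem enlarge_mono {Y : Type*} (δ : Y → Y → ℝ≥0∞) {A B : Set Y} (h : A ⊆ B) (ε : ℝ) :
    enlarge δ A ε ⊆ enlarge δ B ε :=
  fun _ ⟨a, ha, hx⟩ => ⟨a, h ha, hx⟩

end Topometric

open Topometric in
theorem mainTheorem7 {X : Type*} [MetricSpace X] [CompleteSpace X]
    [TopologicalSpace.SeparableSpace X]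
    (G : Subgroup (X ≃ᵢ X)) (hG : IsClosed (G : Set (X ≃ᵢ X)))
    (hO : Topometric.ApproximatelyOligomorphic G X)
    (hA : Topometric.HasAmpleGenerics G (Topometric.uniformDist (X := X) G)) :
    Topometric.MetricallyBergman G (Topometric.uniformDist (X := X) G) 21 := by
  intro W hW hWu ε hε
  have := polishSpace_isometryEquiv (X := X)
  have : PolishSpace G := hG.isClosedEmbedding_subtypeVal.polishSpace
  have hδ := isBiinvariantMetric_uniformDist G
  let W' : ℕ → Set G := fun n => W n ∩ (W n)⁻¹
  have hW' : Monotone W' := fun m n h => inter_subset_inter (hW h) (inv_subset_inv.2 (hW h))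
  have hexh : ∀ g : G, ∃ n, g ∈ W' n := by
    intro g
    obtain ⟨m, hm⟩ := mem_iUnion.1 (hWu ▸ mem_univ g : g ∈ ⋃ n, W n)
    obtain ⟨n, hn⟩ := mem_iUnion.1 (hWu ▸ mem_univ g⁻¹ : g⁻¹ ∈ ⋃ n, W n)
    exact ⟨max m n, hW (le_max_left _ _) hm, hW (le_max_right _ _) hn⟩
  obtain ⟨n, hn⟩ := hA.exists_enlarge_pow_mem_nhds_one hδ hW'
    (eq_univ_of_forall fun g => mem_iUnion.2 (hexh g))
    (fun n => by simp only [W', inter_inv, inv_inv, inter_comm]) hε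
  obtain ⟨m, a, η, hη, ha⟩ := exists_approx_stabilizer_subset G hn
  obtain ⟨F, hF, hFG⟩ := hO.exists_finite_double_cosets a hη
  choose N hN using hexh
  -- Including `1` makes the powers of `E` increasing, which allows passing from 13 to 21.
  obtain ⟨k, hk⟩ := ((hF.insert 1).image N).bddAbove
  set E := enlarge (uniformDist (X := X) G) (W' (max k n)) ε
  have hFE : ∀ f ∈ insert 1 F, f ∈ E := fun f hf => hδ.subset_enlarge _ hε
    (hW' ((hk (mem_image_of_mem N hf)).trans (le_max_left _ _)) (hN f))
  have hnE : enlarge (uniformDist (X := X) G) (W' n) ε ^ 6 ⊆ E ^ 6 :=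
    pow_subset_pow_left (enlarge_mono _ (hW' (le_max_right _ _)) ε)
  refine ⟨max k n, eq_univ_of_forall fun g => ?_⟩
  obtain ⟨v, w, f, hf, rfl, hv, hw⟩ := hFG g
  have hg : v * f * w ∈ E ^ 13 := by
    rw [show E ^ 13 = E ^ 6 * E * E ^ 6 by rw [← pow_succ, ← pow_add]]
    exact mul_mem_mul (mul_mem_mul (hnE (ha v hv)) (hFE f (mem_insert_of_mem _ hf)))
      (hnE (ha w hw))
  exact pow_subset_pow_left (enlarge_mono _ inter_subset_left ε)
    (pow_subset_pow_right (hFE 1 (mem_insert _ _)) (by norm_num) hg)
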